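/- All graphs are finite and simple. For a connected graph $G$ and a set $S\subseteq V(G)$, let $d_G(S)$ denote the Steiner distance of $S$, i.e. the least number of edges of a connected subgraph of $G$ containing $S$. For an integer $2\le k\le |V(G)|$ and a vertex $v$, the Steiner $k$-distance of $v$ is $$d_k^G(v)=\sum_{S\subseteq V(G)\setminus\{v\},\ |S|=k-1} d_G(\{v\}\cup S).$$ A leaf is a vertex of degree $1$. For $1\le r\le n-1$, an $r$-comet on $n$ vertices is a tree formed by attaching $n-r$ pendant vertices to one end vertex (the hub) of a path of length $r-1$; let $a$ denote any one of the $n-r$ attached pendant vertices, and $b$ the other end vertex of the path (for $r=1$ the path is a single vertex and $b$ is the hub). **Theorem.** Let $2\le k\le n$ be integers, and for integers $1\le r\le n-1$ put $$F_r = 1+\frac{\binom{n-2}{k}-\binom{n-r}{k}-\binom{r-1}{k}}{\binom{n-r}{k}+(n-r-1)\binom{n-2}{k-2}+r\binom{n-1}{k-1}-\binom{n-1}{k}}.$$ Let $1\le r\le n-1$ be an integer for which $F_r$ is maximal, and let $F=F_r$. Then: 1. For every tree $T$ on $n$ vertices and all leaves $v,w$ of $T$, $$\frac1F\le\frac{d_k^T(v)}{d_k^T(w)}\le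 F.$$ 2. The bounds are attained by $r$-comets: if $T$ is an $r$-comet on $n$ vertices with $a$ and $b$ as above, then $$\frac{d_k^T(b)}{d_k^T(a)}=F\qquad\text{and}\qquad \frac{d_k^T(a)}{d_k^T(b)}=\frac1F .$$ Here $a$ is a leaf of $T$, and $b$ is a leaf of $T$ whenever $r\ge2$ or $n=2$. The maximizing $r$ can always be chosen so that $r\ge 2$ or $n=2$. -/

import Mathlib

namespace SimpleGraph

/-- The Steiner distance of a vertex set `S` in `G`: the least number of edges of a connected
subgraph of `G` whose vertex set contains `S`. -/
noncomputable def steinerDist {V : Type*} (G : SimpleGraph V) (S : Set V) : ℕ :=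
  sInf {m : ℕ | ∃ H : G.Subgraph, H.Connected ∧ S ⊆ H.verts ∧ H.edgeSet.ncard = m}

/-- The Steiner `k`-distance of a vertex `v`: the sum of the Steiner distances of `{v} ∪ S`
over all sets `S` of `k - 1` vertices with `v ∉ S`. -/
noncomputable def steinerKDist {V : Type*} [Fintype V] [DecidableEq V]
    (G : SimpleGraph V) (k : ℕ) (v : V) : ℕ :=
  ∑ S ∈ (Finset.univ.erase v).powersetCard (k - 1), G.steinerDist ({v} ∪ (S : Set V))

/-- A leaf is a vertex with exactly one neighbour. -/
def IsLeafVertex {V : Type*} (G : SimpleGraph V) (v : V) : Prop :=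
  ∃! u, G.Adj v u

/-- The `r`-comet on the vertices `0, …, n - 1` (for `1 ≤ r ≤ n - 1`): the vertices
`0, 1, …, r - 1` form a path (of length `r - 1`), and each of the `n - r` remaining vertices
`r, …, n - 1` is joined to the end vertex `r - 1` of that path only. -/
def comet (n r : ℕ) : SimpleGraph (Fin n) :=
  SimpleGraph.fromRel fun i j =>
    (j.val < r ∧ i.val + 1 = j.val) ∨ (r ≤ j.val ∧ i.val + 1 = r)

/-- `T` is an `r`-comet on `n` vertices in which `a` is one of the `n - r` leaves attached to the
hub, and `b` is the end of the path opposite to the hub. -/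
def IsComet {V : Type*} (T : SimpleGraph V) (n r : ℕ) (a b : V) : Prop :=
  ∃ φ : comet n r ≃g T, ∃ i j : Fin n, r ≤ i.val ∧ j.val = 0 ∧ φ i = a ∧ φ j = b

end SimpleGraph

/-- The explicit expression `F` as a function of `n`, `k` and `r`. -/
noncomputable def leafRatioBound (n k r : ℕ) : ℝ :=
  1 + (((n - 2).choose k : ℝ) - ((n - r).choose k : ℝ) - ((r - 1).choose k : ℝ)) /
    (((n - r).choose k : ℝ) + ((n : ℝ) - (r : ℝ) - 1) * ((n - 2).choose (k - 2) : ℝ)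
      + (r : ℝ) * ((n - 1).choose (k - 1) : ℝ) - ((n - 1).choose k : ℝ))

/-- `r` is an integer with `1 ≤ r ≤ n - 1` that maximizes `F` over this range. -/
def IsLeafRatioMaximizer (n k r : ℕ) : Prop :=
  (1 ≤ r ∧ r ≤ n - 1) ∧
    ∀ s : ℕ, 1 ≤ s → s ≤ n - 1 → leafRatioBound n k s ≤ leafRatioBound n k r

/-! In a tree, the minimal subtree containing `v` and `S` consists of the edges that separate `v`
from some vertex of `S`. Double counting turns the `k`-distance of `v` into a sum over edges of
`Nat.chooseMeet n k m`, nondecreasing in the number `m` of vertices beyond the edge as seen from `v`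
(`IsTree.steinerKDist_eq_sum`). Let `w` be a leaf at distance `r ≥ 1` from `v`. Edges off the
`v`-`w` path contribute equally to both vertices. On the path the two far sides are complementary,
and beyond the `i`-th edge from `v` there are, as seen from `w`, at least `i` vertices. Hence the
`r`-comet simultaneously minimizes `d(w)` and maximizes `d(v) - d(w)`
(`IsTree.steinerKDist_le_comet`). Since `d(v)/d(w) = 1 + (d(v) - d(w))/d(w)`, a ratio above 1 is at
most that of the comet, which hockey-stick sums identify with `F_r` (`leafRatioBound_eq`).
Exchanging `v` and `w` gives the lower bound. -/

namespace SimpleGraph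

/-! ### Steiner distances in trees as sums over edges. -/

/-- The vertices that are separated from `v` in `G` when the edge `e` is removed. -/
def farSide {V : Type*} (G : SimpleGraph V) (e : Sym2 V) (v : V) : Set V :=
  {s | ¬ (G.deleteEdges {e}).Reachable v s}

lemma mem_farSide_iff {V : Type*} {G : SimpleGraph V} {e : Sym2 V} {v s : V} :
    s ∈ G.farSide e v ↔ ∀ p : G.Walk v s, e ∈ p.edges := by
  induction e using Sym2.ind with
  | _ x y => rw [farSide, Set.mem_ofPred_eq, reachable_deleteEdges_iff_exists_walk, not_exists_not]

lemma IsTree.mem_farSide_iff_of_isPath {V : Type*} {G : SimpleGraph V} (hG : G.IsTree)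
    {e : Sym2 V} {v s : V} {p : G.Walk v s} (hp : p.IsPath) :
    s ∈ G.farSide e v ↔ e ∈ p.edges := by
  classical
  refine ⟨fun h ↦ mem_farSide_iff.1 h p, fun h ↦ mem_farSide_iff.2 fun q ↦ ?_⟩
  have : q.bypass = p := (hG.existsUnique_path v s).unique q.bypass_isPath hp
  exact q.edges_bypass_subset_edges (this ▸ h)

lemma self_notMem_farSide {V : Type*} (G : SimpleGraph V) (e : Sym2 V) (v : V) :
    v ∉ G.farSide e v := fun h ↦ h (Reachable.refl _)

lemma mem_edgeSet_of_mem_farSide {V : Type*} {G : SimpleGraph V} (hG : G.Connected)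
    {e : Sym2 V} {v s : V} (h : s ∈ G.farSide e v) : e ∈ G.edgeSet := by
  obtain ⟨p⟩ := hG v s
  exact p.edges_subset_edgeSet (mem_farSide_iff.1 h p)

/-- In a tree, an edge belongs to the minimal subtree containing `v` and `S` if and only if it
separates `v` from a vertex of `S`. -/
lemma IsTree.steinerDist_eq_ncard {V : Type*} [Finite V] {G : SimpleGraph V} (hG : G.IsTree)
    (v : V) (S : Set V) :
    G.steinerDist ({v} ∪ S) = {e | ∃ s ∈ S, s ∈ G.farSide e v}.ncard := by
  choose P hP using fun s ↦ (hG.existsUnique_path v s).exists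
  apply le_antisymm
  · let H : G.Subgraph := ⨆ s : ({v} ∪ S : Set V), (P s).toSubgraph
    have hle (s : ({v} ∪ S : Set V)) : (P s).toSubgraph ≤ H :=
      le_iSup (fun s : ({v} ∪ S : Set V) ↦ (P s).toSubgraph) s
    have hwalk {u : V} (hu : u ∈ H.verts) : ∃ p : G.Walk v u, p.toSubgraph ≤ H := by
      simp only [H, Subgraph.verts_iSup, Set.mem_iUnion] at hu
      obtain ⟨s, hs⟩ := hu
      obtain ⟨p, hp⟩ := (Subgraph.preconnected_iff_forall_exists_walk_subgraph _).1
        (P s).toSubgraph_connected.preconnected (P s).start_mem_verts_toSubgraph hs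
      exact ⟨p, hp.trans (hle s)⟩
    refine Nat.sInf_le ⟨H, ?_, ?_, ?_⟩
    · refine (Subgraph.connected_iff_forall_exists_walk_subgraph _).2
        ⟨⟨v, (hle ⟨v, by simp⟩).1 (P v).start_mem_verts_toSubgraph⟩, fun {a b} ha hb ↦ ?_⟩
      obtain ⟨p, hp⟩ := hwalk ha
      obtain ⟨q, hq⟩ := hwalk hb
      refine ⟨p.reverse.append q, ?_⟩
      rw [Walk.toSubgraph_append, Walk.toSubgraph_reverse]
      exact sup_le hp hq
    · exact fun s hs ↦ (hle ⟨s, hs⟩).1 (P s).end_mem_verts_toSubgraph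
    · congr 1
      ext e
      simp only [H, Subgraph.edgeSet_iSup, Set.mem_iUnion, Walk.mem_edges_toSubgraph,
        ← hG.mem_farSide_iff_of_isPath (hP _), Set.mem_ofPred_eq, Subtype.exists]
      constructor
      · rintro ⟨s, hs | hs, h⟩
        · obtain rfl : s = v := hs
          exact absurd h (self_notMem_farSide G e s)
        · exact ⟨s, hs, h⟩
      · rintro ⟨s, hs, h⟩
        exact ⟨s, Or.inr hs, h⟩
  · have : Nonempty V := ⟨v⟩
    refine le_csInf ?_ ?_
    -- The infimum of the empty set would be 0, so some admissible subgraph is needed: the whole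
    -- tree.
    · refine ⟨_, ⊤, ?_, by simp, rfl⟩
      refine (Subgraph.connected_iff_forall_exists_walk_subgraph _).2 ⟨⟨v, by simp⟩, ?_⟩
      intro a b _ _
      exact ⟨(hG.connected a b).some, le_top⟩
    · rintro m ⟨H, hH, hS, rfl⟩
      refine Set.ncard_le_ncard ?_ (Set.toFinite _)
      rintro e ⟨s, hs, h⟩
      obtain ⟨p, hp⟩ := (Subgraph.preconnected_iff_forall_exists_walk_subgraph _).1
        hH.preconnected (hS (Or.inl rfl)) (hS (Or.inr hs))
      exact Subgraph.edgeSet_mono hp (p.mem_edges_toSubgraph.2 (mem_farSide_iff.1 h p))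

/-- The number of `(k - 1)`-subsets of a set of `n - 1` elements that meet a fixed subset of `m`
elements. -/
def _root_.Nat.chooseMeet (n k m : ℕ) : ℕ :=
  (n - 1).choose (k - 1) - (n - 1 - m).choose (k - 1)

/-- Complementary counting: the `j`-subsets that fail are exactly the `j`-subsets of the elements
without `p`. -/
lemma _root_.Finset.card_filter_powersetCard_exists {α : Type*} (A : Finset α) (p : α → Prop)
    (j : ℕ) [DecidablePred p] [DecidablePred fun S : Finset α ↦ ∃ s ∈ S, p s] :
    ((A.powersetCard j).filter fun S ↦ ∃ s ∈ S, p s).card =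
      A.card.choose j - (A.card - (A.filter p).card).choose j := by
  classical
  have h1 := Finset.card_filter_add_card_filter_not (s := A.powersetCard j)
    (fun S ↦ ∃ s ∈ S, p s)
  have h2 : ((A.powersetCard j).filter fun S ↦ ¬ ∃ s ∈ S, p s) =
      (A.filter fun s ↦ ¬ p s).powersetCard j := by
    ext S
    simp only [Finset.mem_filter, Finset.mem_powersetCard, not_exists, not_and,
      Finset.subset_iff]
    grind
  have h3 := Finset.card_filter_add_card_filter_not (s := A) p
  rw [h2, Finset.card_powersetCard, Finset.card_powersetCard] at h1
  rw [show A.card - (A.filter p).card = (A.filter fun s ↦ ¬ p s).card by omega]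
  omega

lemma IsTree.steinerKDist_eq_sum {V : Type*} [Fintype V] [DecidableEq V] {G : SimpleGraph V}
    [Fintype G.edgeSet] (hG : G.IsTree) (k : ℕ) (v : V) :
    G.steinerKDist k v =
      ∑ e ∈ G.edgeFinset, Nat.chooseMeet (Fintype.card V) k (G.farSide e v).ncard := by
  classical
  have h1 (S : Finset V) : G.steinerDist ({v} ∪ (S : Set V)) =
      ∑ e ∈ G.edgeFinset, if ∃ s ∈ S, s ∈ G.farSide e v then 1 else 0 := by
    rw [hG.steinerDist_eq_ncard, ← Finset.card_filter, ← Set.ncard_coe_finset]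
    congr 1
    ext e
    simp only [Finset.coe_filter, Set.mem_ofPred_eq, Finset.mem_coe, mem_edgeFinset]
    exact ⟨fun ⟨s, hs, h⟩ ↦ ⟨mem_edgeSet_of_mem_farSide hG.connected h, s, hs, h⟩, fun h ↦ h.2⟩
  simp only [steinerKDist, h1]
  rw [Finset.sum_comm]
  refine Finset.sum_congr rfl fun e _ ↦ ?_
  rw [← Finset.card_filter, Finset.card_filter_powersetCard_exists,
    Finset.card_erase_of_mem (Finset.mem_univ v), Finset.card_univ, Nat.chooseMeet]
  congr 3
  rw [← Set.ncard_coe_finset]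
  congr 1
  ext s
  simp only [Finset.coe_filter, Finset.mem_erase, Finset.mem_univ, and_true, Set.mem_ofPred_eq,
    and_iff_right_iff_imp]
  rintro h rfl
  exact self_notMem_farSide G e s h

/-! ### Invariance under graph isomorphism. -/

lemma exists_connected_subgraph_image {V W : Type*} {G : SimpleGraph V} {G' : SimpleGraph W}
    (φ : G ≃g G') {S : Set V} {m : ℕ}
    (h : ∃ H : G.Subgraph, H.Connected ∧ S ⊆ H.verts ∧ H.edgeSet.ncard = m) :
    ∃ H : G'.Subgraph, H.Connected ∧ φ '' S ⊆ H.verts ∧ H.edgeSet.ncard = m := by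
  obtain ⟨H, hH, hS, rfl⟩ := h
  refine ⟨H.map φ.toHom, ?_, Set.image_mono hS, ?_⟩
  · rw [Subgraph.connected_iff_forall_exists_walk_subgraph] at hH ⊢
    refine ⟨hH.1.image _, ?_⟩
    rintro _ _ ⟨u, hu, rfl⟩ ⟨v, hv, rfl⟩
    obtain ⟨p, hp⟩ := hH.2 hu hv
    exact ⟨p.map φ.toHom, by rw [Walk.toSubgraph_map]; exact Subgraph.map_mono hp⟩
  · rw [Subgraph.edgeSet_map]
    exact Set.ncard_image_of_injective _ (Sym2.map.injective φ.injective)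

lemma steinerDist_image {V W : Type*} {G : SimpleGraph V} {G' : SimpleGraph W}
    (φ : G ≃g G') (S : Set V) : G'.steinerDist (φ '' S) = G.steinerDist S := by
  rw [steinerDist, steinerDist]
  congr 1
  ext m
  refine ⟨fun h ↦ ?_, exists_connected_subgraph_image φ⟩
  have := exists_connected_subgraph_image φ.symm h
  rwa [← Set.image_comp, show (φ.symm ∘ φ : V → V) = id from funext φ.symm_apply_apply,
    Set.image_id] at this

lemma steinerKDist_apply {V W : Type*} [Fintype V] [DecidableEq V] [Fintype W] [DecidableEq W]
    {G : SimpleGraph V} {G' : SimpleGraph W} (φ : G ≃g G') (k : ℕ) (v : V) :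
    G'.steinerKDist k (φ v) = G.steinerKDist k v := by
  have h : (Finset.univ.erase (φ v)) = (Finset.univ.erase v).map φ.toEquiv.toEmbedding := by
    ext w
    obtain ⟨u, rfl⟩ := φ.surjective w
    simp
  rw [steinerKDist, h, Finset.powersetCard_map, Finset.sum_map, steinerKDist]
  refine Finset.sum_congr rfl fun S _ ↦ ?_
  rw [← steinerDist_image φ, Set.image_union, Set.image_singleton]
  simp

end SimpleGraph

namespace SimpleGraph

/-! ### Far sides seen from two vertices, and along a path. -/

lemma farSide_eq_of_notMem {V : Type*} {G : SimpleGraph V} {e : Sym2 V} {v w : V}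
    (h : w ∉ G.farSide e v) : G.farSide e v = G.farSide e w := by
  have h : (G.deleteEdges {e}).Reachable v w := not_not.1 h
  ext s
  exact not_congr ⟨fun hs ↦ h.symm.trans hs, fun hs ↦ h.trans hs⟩

/-- Follow the walk until it first uses the edge `s(x, y)`, if ever. Thus deleting an edge of a
connected graph leaves at most two components, which makes opposite far sides complementary. -/
lemma reachable_deleteEdges_or {V : Type*} {G : SimpleGraph V} {x y z : V}
    (p : G.Walk z x) : (G.deleteEdges {s(x, y)}).Reachable z x ∨
      (G.deleteEdges {s(x, y)}).Reachable z y := by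
  induction p with
  | nil => exact Or.inl (Reachable.refl _)
  | @cons a b x h p ih =>
    by_cases he : s(a, b) = s(x, y)
    · rcases Sym2.eq_iff.1 he with ⟨rfl, rfl⟩ | ⟨rfl, rfl⟩
      · exact Or.inl (Reachable.refl _)
      · exact Or.inr (Reachable.refl _)
    · have hab : (G.deleteEdges {s(x, y)}).Adj a b := by simp [deleteEdges_adj, h, he]
      exact ih.imp hab.reachable.trans hab.reachable.trans

lemma Connected.farSide_eq_compl {V : Type*} {G : SimpleGraph V} (hG : G.Connected)
    {e : Sym2 V} {v w : V} (h : w ∈ G.farSide e v) : G.farSide e w = (G.farSide e v)ᶜ := by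
  induction e using Sym2.ind with
  | _ x y =>
    have key (z : V) := reachable_deleteEdges_or (y := y) (hG z x).some
    ext s
    simp only [farSide, Set.mem_ofPred_eq, Set.mem_compl_iff, not_not] at h ⊢
    constructor
    · intro hs
      rcases key v with hv | hv <;> rcases key w with hw | hw <;> rcases key s with hs' | hs'
      all_goals first
        | exact absurd (hv.trans hw.symm) h
        | exact absurd (hw.trans hs'.symm) hs
        | exact hv.trans hs'.symm
    · exact fun hs hs' ↦ h (hs.trans hs'.symm)

lemma Connected.ncard_farSide_add {V : Type*} [Fintype V] {G : SimpleGraph V}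
    (hG : G.Connected) {e : Sym2 V} {v w : V} (h : w ∈ G.farSide e v) :
    (G.farSide e v).ncard + (G.farSide e w).ncard = Fintype.card V := by
  rw [hG.farSide_eq_compl h, Set.ncard_add_ncard_compl, Nat.card_eq_fintype_card]

lemma IsTree.ncard_farSide_pos {V : Type*} [Finite V] {G : SimpleGraph V} (hG : G.IsTree)
    {e : Sym2 V} (he : e ∈ G.edgeSet) (w : V) : 0 < (G.farSide e w).ncard := by
  rw [Set.ncard_pos]
  by_contra h
  rw [Set.not_nonempty_iff_eq_empty] at h
  induction e using Sym2.ind with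
  | _ x y =>
    have hr (s : V) : (G.deleteEdges {s(x, y)}).Reachable w s := by
      by_contra hs
      exact (h ▸ hs : s ∈ (∅ : Set V))
    exact isBridge_iff.1 (isAcyclic_iff_forall_isBridge.1 hG.isAcyclic he)
      ((hr x).symm.trans (hr y))

lemma IsLeafVertex.farSide_eq {V : Type*} {G : SimpleGraph V} {w u : V}
    (hw : G.IsLeafVertex w) (h : G.Adj w u) : G.farSide s(u, w) w = {w}ᶜ := by
  ext s
  simp only [farSide, Set.mem_ofPred_eq, Set.mem_compl_iff, Set.mem_singleton_iff]
  refine not_congr ⟨fun ⟨p⟩ ↦ ?_, fun hs ↦ hs ▸ Reachable.refl _⟩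
  cases p with
  | nil => rfl
  | @cons _ b _ hb p =>
    rw [deleteEdges_adj] at hb
    obtain rfl := hw.unique h hb.1
    exact absurd (Sym2.eq_swap) hb.2

lemma Walk.IsPath.sum_edges {V : Type*} [DecidableEq V] {G : SimpleGraph V} {v w : V}
    {p : G.Walk v w} (hp : p.IsPath) (f : Sym2 V → ℕ) :
    ∑ e ∈ p.edges.toFinset, f e =
      ∑ i ∈ Finset.range p.length, f s(p.getVert i, p.getVert (i + 1)) := by
  have h : p.edges = (List.range p.length).map fun i ↦ s(p.getVert i, p.getVert (i + 1)) := by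
    refine List.ext_getElem (by simp) fun i h₁ h₂ ↦ ?_
    rw [Walk.getElem_edges]
    simp
  rw [List.sum_toFinset _ hp.isTrail.edges_nodup, h, List.map_map]
  rfl

/-- The starting segment of a path lies on the far side of its later edges. -/
lemma IsTree.le_ncard_farSide_getVert {V : Type*} [Fintype V] {G : SimpleGraph V}
    (hG : G.IsTree) {v w : V} {p : G.Walk v w} (hp : p.IsPath) {i : ℕ} (hi : i < p.length) :
    i + 1 ≤ (G.farSide s(p.getVert i, p.getVert (i + 1)) w).ncard := by
  classical
  have hsub : ((Finset.range (i + 1)).image p.getVert : Set V) ⊆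
      G.farSide s(p.getVert i, p.getVert (i + 1)) w := by
    intro s hs
    simp only [Finset.coe_image, Finset.coe_range, Set.mem_image, Set.mem_Iio] at hs
    obtain ⟨j, hj, rfl⟩ := hs
    have hmem : p.getVert j ∈ G.farSide s(p.getVert i, p.getVert (i + 1)) w := by
      rw [hG.mem_farSide_iff_of_isPath (hp.drop j).reverse, Walk.edges_reverse,
        List.mem_reverse, Walk.mk_mem_edges_iff_exists]
      refine ⟨i - j, ?_, ?_⟩
      · rw [Walk.drop_length]; omega
      · rw [Walk.drop_getVert, Walk.drop_getVert]
        rw [show j + (i - j) = i by omega, show j + (i - j + 1) = i + 1 by omega]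
    exact hmem
  have := Set.ncard_le_ncard hsub (Set.toFinite _)
  rwa [Set.ncard_coe_finset, Finset.card_image_of_injOn, Finset.card_range] at this
  intro a ha b hb hab
  simp only [Finset.coe_range, Set.mem_Iio] at ha hb
  exact hp.getVert_injOn (by simp only [Set.mem_ofPred_eq]; omega)
    (by simp only [Set.mem_ofPred_eq]; omega) hab

end SimpleGraph

/-! ### Comparison of a tree with the comet. -/

lemma Nat.chooseMeet_mono {n k a b : ℕ} (h : a ≤ b) : Nat.chooseMeet n k a ≤ Nat.chooseMeet n k b :=
  Nat.sub_le_sub_left (Nat.choose_le_choose _ (by omega)) _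

/-- The Steiner `k`-distance of a pendant vertex at the hub of the `r`-comet on `n` vertices. -/
def cometPendantDist (n k r : ℕ) : ℕ :=
  ∑ i ∈ Finset.range (r - 1), Nat.chooseMeet n k (i + 1) + Nat.chooseMeet n k (n - 1) +
    (n - 1 - r) * Nat.chooseMeet n k 1

/-- The Steiner `k`-distance of the path end of the `r`-comet on `n` vertices. -/
def cometEndDist (n k r : ℕ) : ℕ :=
  ∑ i ∈ Finset.range (r - 1), Nat.chooseMeet n k (n - (i + 1)) + Nat.chooseMeet n k 1 +
    (n - 1 - r) * Nat.chooseMeet n k 1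

namespace SimpleGraph

/-- Among all trees with vertices `v` and `w` at distance `r`, where `w` is a leaf, the `r`-comet
minimizes the Steiner distance of `w` and maximizes the difference of the Steiner distances. -/
lemma IsTree.steinerKDist_le_comet {V : Type*} [Fintype V] [DecidableEq V] {G : SimpleGraph V}
    (hG : G.IsTree) (k : ℕ) {v w : V} (hw : G.IsLeafVertex w) {p : G.Walk v w} (hp : p.IsPath)
    (hvw : 0 < p.length) :
    cometPendantDist (Fintype.card V) k p.length ≤ G.steinerKDist k w ∧
    G.steinerKDist k v + cometPendantDist (Fintype.card V) k p.length ≤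
      G.steinerKDist k w + cometEndDist (Fintype.card V) k p.length := by
  classical
  set n := Fintype.card V with hn
  set g := Nat.chooseMeet n k with hg
  have hsub : p.edges.toFinset ⊆ G.edgeFinset := by
    intro e he
    rw [mem_edgeFinset]
    exact p.edges_subset_edgeSet (List.mem_toFinset.1 he)
  have hcard : (G.edgeFinset \ p.edges.toFinset).card = n - 1 - p.length := by
    rw [Finset.card_sdiff_of_subset hsub, List.toFinset_card_of_nodup hp.isTrail.edges_nodup,
      Walk.length_edges]
    have := hG.card_edgeFinset
    omega
  have hlen := hp.length_lt
  -- The last path edge, the one at the leaf `w`, is split off: its far sides have exactly `n - 1`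
  -- and `1` vertices.
  obtain ⟨l, hl⟩ : ∃ l, p.length = l + 1 := ⟨p.length - 1, by omega⟩
  have hsum (u : V) : G.steinerKDist k u =
      ∑ i ∈ Finset.range l, g (G.farSide s(p.getVert i, p.getVert (i + 1)) u).ncard +
        g (G.farSide s(p.getVert l, p.getVert (l + 1)) u).ncard +
        ∑ e ∈ G.edgeFinset \ p.edges.toFinset, g (G.farSide e u).ncard := by
    rw [hG.steinerKDist_eq_sum, ← Finset.sum_sdiff hsub, add_comm, hp.sum_edges, hl,
      Finset.sum_range_succ]
  have hoff : ∑ e ∈ G.edgeFinset \ p.edges.toFinset, g (G.farSide e v).ncard =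
      ∑ e ∈ G.edgeFinset \ p.edges.toFinset, g (G.farSide e w).ncard := by
    refine Finset.sum_congr rfl fun e he ↦ ?_
    rw [farSide_eq_of_notMem]
    rw [hG.mem_farSide_iff_of_isPath hp]
    simpa using (Finset.mem_sdiff.1 he).2
  have hoff1 : (n - 1 - p.length) * g 1 ≤
      ∑ e ∈ G.edgeFinset \ p.edges.toFinset, g (G.farSide e w).ncard := by
    rw [← hcard, ← smul_eq_mul]
    refine Finset.card_nsmul_le_sum _ _ _ fun e he ↦ Nat.chooseMeet_mono ?_
    exact hG.ncard_farSide_pos (mem_edgeFinset.1 (Finset.mem_sdiff.1 he).1) w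
  have hadd {i : ℕ} (hi : i < p.length) :
      (G.farSide s(p.getVert i, p.getVert (i + 1)) v).ncard +
        (G.farSide s(p.getVert i, p.getVert (i + 1)) w).ncard = n := by
    refine hG.connected.ncard_farSide_add ?_
    rw [hG.mem_farSide_iff_of_isPath hp, Walk.mk_mem_edges_iff_exists]
    exact ⟨i, hi, rfl⟩
  have hlast : (G.farSide s(p.getVert l, p.getVert (l + 1)) w).ncard = n - 1 := by
    have h1 : G.Adj (p.getVert l) (p.getVert (l + 1)) := p.adj_getVert_succ (by omega)
    have h2 : p.getVert (l + 1) = w := by rw [← hl, p.getVert_length]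
    rw [h2] at h1 ⊢
    rw [hw.farSide_eq h1.symm, Set.ncard_compl, Set.ncard_singleton, Nat.card_eq_fintype_card]
  have hlast' : (G.farSide s(p.getVert l, p.getVert (l + 1)) v).ncard = 1 := by
    have := hadd (i := l) (by omega)
    omega
  have hge {i : ℕ} (hi : i ∈ Finset.range l) :
      i + 1 ≤ (G.farSide s(p.getVert i, p.getVert (i + 1)) w).ncard :=
    hG.le_ncard_farSide_getVert hp (by rw [Finset.mem_range] at hi; omega)
  rw [hsum v, hsum w, hoff, hlast, hlast', cometPendantDist, cometEndDist, ← hg,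
    show p.length - 1 = l by omega]
  have hmin : ∑ i ∈ Finset.range l, g (i + 1) ≤
      ∑ i ∈ Finset.range l, g (G.farSide s(p.getVert i, p.getVert (i + 1)) w).ncard :=
    Finset.sum_le_sum fun i hi ↦ Nat.chooseMeet_mono (hge hi)
  -- The lower bound on the far side from `w` becomes an upper bound on its complement.
  have hmax : ∑ i ∈ Finset.range l, g (G.farSide s(p.getVert i, p.getVert (i + 1)) v).ncard ≤
      ∑ i ∈ Finset.range l, g (n - (i + 1)) := by
    refine Finset.sum_le_sum fun i hi ↦ Nat.chooseMeet_mono ?_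
    have := hge hi
    have := hadd (i := i) (by rw [Finset.mem_range] at hi; omega)
    omega
  constructor <;> omega

end SimpleGraph

/-! ### Closed forms for the comet and the values of `F`. -/

lemma Nat.sum_range_choose_sub (m j r : ℕ) (hr : r ≤ m) :
    ∑ i ∈ Finset.range r, (m - (i + 1)).choose j + (m - r).choose (j + 1) =
      m.choose (j + 1) := by
  induction r with
  | zero => simp
  | succ r ih =>
    rw [Finset.sum_range_succ, ← ih (by omega), add_assoc,
      show m - r = (m - (r + 1)) + 1 by omega, Nat.choose_succ_succ]

lemma Nat.sum_range_choose_right (j r : ℕ) :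
    ∑ i ∈ Finset.range r, i.choose j = r.choose (j + 1) := by
  induction r with
  | zero => simp
  | succ r ih => rw [Finset.sum_range_succ, ih, Nat.choose_succ_succ, add_comm]

lemma Nat.cast_chooseMeet (n k m : ℕ) : (Nat.chooseMeet n k m : ℝ) =
    ((n - 1).choose (k - 1) : ℝ) - ((n - 1 - m).choose (k - 1) : ℝ) :=
  Nat.cast_sub (Nat.choose_le_choose _ (by omega))

lemma cometPendantDist_pos {n k r : ℕ} (hk : 2 ≤ k) (hkn : k ≤ n) :
    0 < cometPendantDist n k r := by
  have h : 0 < Nat.chooseMeet n k (n - 1) := by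
    rw [Nat.chooseMeet, Nat.sub_self, Nat.choose_eq_zero_of_lt (show 0 < k - 1 by omega)]
    exact Nat.choose_pos (by omega)
  rw [cometPendantDist]
  omega

/-- The path terms sum by the hockey-stick identity, `Nat.chooseMeet n k 1` is `(n - 2).choose (k -
2)` by Pascal's rule, and `Nat.chooseMeet n k (n - 1)` loses its subtracted term because `k - 1 >
0`. -/
lemma cast_cometPendantDist {n k r : ℕ} (hk : 2 ≤ k) (hkn : k ≤ n) (h1 : 1 ≤ r)
    (hr : r ≤ n - 1) : (cometPendantDist n k r : ℝ) =
      ((n - r).choose k : ℝ) + ((n : ℝ) - (r : ℝ) - 1) * ((n - 2).choose (k - 2) : ℝ)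
        + (r : ℝ) * ((n - 1).choose (k - 1) : ℝ) - ((n - 1).choose k : ℝ) := by
  obtain ⟨j, rfl⟩ : ∃ j, k = j + 2 := ⟨k - 2, by omega⟩
  obtain ⟨r, rfl⟩ : ∃ s, r = s + 1 := ⟨r - 1, by omega⟩
  obtain ⟨m, rfl⟩ : ∃ m, n = m + 2 := ⟨n - 2, by omega⟩
  have h2 := Nat.sum_range_choose_sub (m + 1) (j + 1) r (by omega)
  have h3 : (m + 1).choose (j + 1) = m.choose j + m.choose (j + 1) := Nat.choose_succ_succ ..
  simp only [cometPendantDist, Nat.cast_add, Nat.cast_sum, Nat.cast_mul, Nat.cast_chooseMeet,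
    Nat.add_sub_cancel, Nat.sub_self, Finset.sum_sub_distrib, Finset.sum_const,
    Finset.card_range, nsmul_eq_mul, show m + 2 - 1 = m + 1 by omega,
    show j + 2 - 1 = j + 1 by omega, Nat.choose_zero_succ,
    show m + 2 - (r + 1) = m + 1 - r by omega,
    Nat.cast_sub (show r + 1 ≤ m + 1 by omega)]
  have h2' : (∑ i ∈ Finset.range r, ((m + 1 - (i + 1)).choose (j + 1) : ℝ)) =
      ((m + 1).choose (j + 2) : ℝ) - ((m + 1 - r).choose (j + 2) : ℝ) := by
    rw [← h2]; push_cast; ring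
  rw [h2', h3]
  push_cast
  ring

lemma cast_cometEndDist_sub {n k r : ℕ} (hk : 2 ≤ k) (hkn : k ≤ n) (h1 : 1 ≤ r)
    (hr : r ≤ n - 1) : (cometEndDist n k r : ℝ) - cometPendantDist n k r =
      ((n - 2).choose k : ℝ) - ((n - r).choose k : ℝ) - ((r - 1).choose k : ℝ) := by
  obtain ⟨j, rfl⟩ : ∃ j, k = j + 2 := ⟨k - 2, by omega⟩
  obtain ⟨r, rfl⟩ : ∃ s, r = s + 1 := ⟨r - 1, by omega⟩
  obtain ⟨m, rfl⟩ : ∃ m, n = m + 2 := ⟨n - 2, by omega⟩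
  have h2 := Nat.sum_range_choose_sub (m + 1) (j + 1) r (by omega)
  have h3 : (m + 1).choose (j + 2) = m.choose (j + 1) + m.choose (j + 2) :=
    Nat.choose_succ_succ ..
  have h4 : ∑ i ∈ Finset.range r, (m + 1 - (m + 2 - (i + 1))).choose (j + 1) =
      r.choose (j + 2) := by
    rw [← Nat.sum_range_choose_right]
    refine Finset.sum_congr rfl fun i hi ↦ ?_
    rw [Finset.mem_range] at hi
    rw [show m + 1 - (m + 2 - (i + 1)) = i by omega]
  simp only [cometPendantDist, cometEndDist, Nat.cast_add, Nat.cast_sum, Nat.cast_mul,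
    Nat.cast_chooseMeet,
    Nat.add_sub_cancel, Nat.sub_self, Finset.sum_sub_distrib, Finset.sum_const,
    Finset.card_range, nsmul_eq_mul, show m + 2 - 1 = m + 1 by omega,
    show j + 2 - 1 = j + 1 by omega, Nat.choose_zero_succ,
    show m + 2 - (r + 1) = m + 1 - r by omega]
  have h2' : (∑ i ∈ Finset.range r, ((m + 1 - (i + 1)).choose (j + 1) : ℝ)) =
      ((m + 1).choose (j + 2) : ℝ) - ((m + 1 - r).choose (j + 2) : ℝ) := by
    rw [← h2]; push_cast; ring
  have h4' : (∑ i ∈ Finset.range r, ((m + 1 - (m + 2 - (i + 1))).choose (j + 1) : ℝ)) =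
      (r.choose (j + 2) : ℝ) := by
    rw [← h4]; push_cast; ring
  rw [h2', h4', h3]
  push_cast
  ring

lemma leafRatioBound_eq {n k r : ℕ} (hk : 2 ≤ k) (hkn : k ≤ n) (h1 : 1 ≤ r) (hr : r ≤ n - 1) :
    leafRatioBound n k r = cometEndDist n k r / cometPendantDist n k r := by
  have h : (0 : ℝ) < cometPendantDist n k r := by exact_mod_cast cometPendantDist_pos hk hkn
  rw [leafRatioBound, ← cast_cometEndDist_sub hk hkn h1 hr, ← cast_cometPendantDist hk hkn h1 hr]
  field_simp
  ring

/-- Gives `F ≥ 1` when `n ≥ 3`, and lets `r = 2` replace `r = 1` as a maximizer. -/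
lemma leafRatioBound_two {n k : ℕ} (hk : 2 ≤ k) : leafRatioBound n k 2 = 1 := by
  simp [leafRatioBound, Nat.choose_eq_zero_of_lt (show 1 < k by omega)]

lemma leafRatioBound_one_le {n k : ℕ} (hk : 2 ≤ k) (hkn : k ≤ n) : leafRatioBound n k 1 ≤ 1 := by
  have h : (0 : ℝ) < cometPendantDist n k 1 := by exact_mod_cast cometPendantDist_pos hk hkn
  rw [cast_cometPendantDist hk hkn le_rfl (by omega)] at h
  have h1 : ((n - 2).choose k : ℝ) ≤ ((n - 1).choose k : ℝ) := by
    exact_mod_cast Nat.choose_le_choose k (by omega)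
  rw [leafRatioBound, Nat.sub_self, Nat.choose_eq_zero_of_lt (show 0 < k by omega)]
  have : (((n - 2).choose k : ℝ) - ((n - 1).choose k : ℝ) - ((0 : ℕ) : ℝ)) ≤ 0 := by
    push_cast; linarith
  linarith [div_nonpos_of_nonpos_of_nonneg this h.le]

lemma IsLeafRatioMaximizer.one_le {n k r : ℕ} (hk : 2 ≤ k) (hkn : k ≤ n)
    (hr : IsLeafRatioMaximizer n k r) : 1 ≤ leafRatioBound n k r := by
  by_cases hn : n = 2
  · subst hn
    obtain rfl : k = 2 := by omega
    obtain rfl : r = 1 := by have := hr.1; omega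
    norm_num [leafRatioBound, Nat.choose]
  · exact (leafRatioBound_two (n := n) hk).symm.le.trans (hr.2 2 (by omega) (by omega))

lemma exists_isLeafRatioMaximizer {n k : ℕ} (hk : 2 ≤ k) (hkn : k ≤ n) :
    ∃ r, IsLeafRatioMaximizer n k r ∧ (2 ≤ r ∨ n = 2) := by
  obtain ⟨r, hr, hmax⟩ := Finset.exists_max_image (Finset.Icc 1 (n - 1)) (leafRatioBound n k)
    ⟨1, by simp; omega⟩
  rw [Finset.mem_Icc] at hr
  have hr' : IsLeafRatioMaximizer n k r := ⟨hr, fun s h1 h2 ↦ hmax s (by simp [h1, h2])⟩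
  by_cases h : 2 ≤ r ∨ n = 2
  · exact ⟨r, hr', h⟩
  · obtain rfl : r = 1 := by omega
    refine ⟨2, ⟨by omega, fun s h1 h2 ↦ (hr'.2 s h1 h2).trans ?_⟩, Or.inl le_rfl⟩
    rw [leafRatioBound_two hk]
    exact leafRatioBound_one_le hk hkn

/-! ### The upper bound for trees. -/

lemma SimpleGraph.IsTree.steinerKDist_div_le {V : Type*} [Fintype V] [DecidableEq V]
    {G : SimpleGraph V} (hG : G.IsTree) {k r : ℕ} (hk : 2 ≤ k) (hkn : k ≤ Fintype.card V)
    (hr : IsLeafRatioMaximizer (Fintype.card V) k r) {v w : V} (hw : G.IsLeafVertex w) :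
    (G.steinerKDist k v : ℝ) / (G.steinerKDist k w : ℝ) ≤
      leafRatioBound (Fintype.card V) k r := by
  obtain ⟨p, hp⟩ := (hG.existsUnique_path v w).exists
  by_cases hle : G.steinerKDist k v ≤ G.steinerKDist k w
  · refine le_trans ?_ (hr.one_le hk hkn)
    exact div_le_one_of_le₀ (by exact_mod_cast hle) (Nat.cast_nonneg _)
  · have hpos : 0 < p.length := by
      rw [Nat.pos_iff_ne_zero]
      intro h
      obtain rfl := Walk.eq_of_length_eq_zero h
      exact hle le_rfl
    have hlen := hp.length_lt
    refine le_trans ?_ (hr.2 p.length hpos (by omega))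
    obtain ⟨h1, h2⟩ := hG.steinerKDist_le_comet k hw hp hpos
    have h3 := cometPendantDist_pos (r := p.length) hk hkn
    rw [leafRatioBound_eq hk hkn hpos (by omega)]
    generalize cometPendantDist (Fintype.card V) k p.length = c at *
    generalize cometEndDist (Fintype.card V) k p.length = d at *
    generalize G.steinerKDist k v = x at *
    generalize G.steinerKDist k w = y at *
    have h1' : (c : ℝ) ≤ y := by exact_mod_cast h1
    have h2' : (x : ℝ) + c ≤ y + d := by exact_mod_cast h2
    have h3' : (0 : ℝ) < c := by exact_mod_cast h3
    have h4' : (y : ℝ) < x := by exact_mod_cast not_le.1 hle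
    rw [div_le_div_iff₀ (by linarith) h3']
    -- `x * c = y * c + (x - y) * c ≤ y * c + (x - y) * y ≤ y * c + (d - c) * y = d * y`.
    nlinarith [mul_le_mul_of_nonneg_left h1' (show (0 : ℝ) ≤ x - y by linarith),
      mul_le_mul_of_nonneg_left (show (x : ℝ) - y ≤ d - c by linarith)
        (show (0 : ℝ) ≤ y by linarith)]

lemma SimpleGraph.IsTree.steinerKDist_pos {V : Type*} [Fintype V] [DecidableEq V]
    {G : SimpleGraph V} (hG : G.IsTree) {k : ℕ} (hk : 2 ≤ k) (hkn : k ≤ Fintype.card V)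
    {w : V} (hw : G.IsLeafVertex w) : 0 < G.steinerKDist k w := by
  obtain ⟨v, hv, -⟩ := id hw
  obtain ⟨p, hp⟩ := (hG.existsUnique_path v w).exists
  have hpos : 0 < p.length := by
    rw [Nat.pos_iff_ne_zero]
    intro h
    obtain rfl := Walk.eq_of_length_eq_zero h
    exact hv.ne rfl
  exact (cometPendantDist_pos hk hkn).trans_le (hG.steinerKDist_le_comet k hw hp hpos).1

namespace SimpleGraph

/-! ### The comet as a rooted tree, and its Steiner distances. -/

lemma comet_adj_iff {n r : ℕ} {x y : Fin n} : (comet n r).Adj x y ↔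
    x.val + 1 = min y.val r ∨ y.val + 1 = min x.val r := by
  rw [comet, fromRel_adj, Ne, Fin.ext_iff]
  omega

/-- The neighbour of the vertex `i + 1` of the comet that is closer to the vertex `0`. -/
def cometParent (m r : ℕ) (i : Fin m) : Fin (m + 1) :=
  ⟨min (i.val + 1) r - 1, by omega⟩

/-- The edge of the comet that joins the vertex `i + 1` to its parent. -/
def cometEdge (m r : ℕ) (i : Fin m) : Sym2 (Fin (m + 1)) :=
  s(cometParent m r i, i.succ)

lemma comet_adj_cometParent {m r : ℕ} (hr : 1 ≤ r) (i : Fin m) :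
    (comet (m + 1) r).Adj (cometParent m r i) i.succ := by
  rw [comet_adj_iff, cometParent, Fin.val_succ]
  left
  dsimp only
  omega

lemma cometEdge_injective (m r : ℕ) : Function.Injective (cometEdge m r) := by
  intro i j h
  rw [cometEdge, cometEdge, Sym2.eq_iff] at h
  simp only [cometParent, Fin.ext_iff, Fin.val_succ] at h ⊢
  omega

lemma comet_edgeSet_eq {m r : ℕ} (hr : 1 ≤ r) :
    (comet (m + 1) r).edgeSet = Set.range (cometEdge m r) := by
  ext e
  constructor
  · induction e using Sym2.ind with
    | _ x y =>
      rw [mem_edgeSet, comet_adj_iff]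
      rintro (h | h)
      · refine ⟨⟨y.val - 1, by omega⟩, ?_⟩
        rw [cometEdge, Sym2.eq_iff]
        simp only [cometParent, Fin.ext_iff, Fin.val_succ]
        omega
      · refine ⟨⟨x.val - 1, by omega⟩, ?_⟩
        rw [cometEdge, Sym2.eq_iff]
        simp only [cometParent, Fin.ext_iff, Fin.val_succ]
        omega
  · rintro ⟨i, rfl⟩
    exact comet_adj_cometParent hr i

/-- Parents have smaller labels, so climbing inside `A` must stop at `z`; the root `0`, having no
parent, may lie in `A` only if it is `z`. Used for connectedness and for both sides of a deleted
edge. -/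
lemma comet_reachable_zero {m r : ℕ} {G : SimpleGraph (Fin (m + 1))} (A : Set (Fin (m + 1)))
    (z : Fin (m + 1))
    (h : ∀ i : Fin m, i.succ ∈ A → i.succ ≠ z →
      cometParent m r i ∈ A ∧ G.Adj (cometParent m r i) i.succ)
    (h0 : 0 ∈ A → z = 0) (x : Fin (m + 1)) (hx : x ∈ A) : G.Reachable z x := by
  induction hd : x.val using Nat.strong_induction_on generalizing x with
  | _ d ih =>
    by_cases hxz : x = z
    · rw [hxz]
    · cases x using Fin.cases with
      | zero => exact absurd (h0 hx).symm hxz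
      | succ i =>
        obtain ⟨h1, h2⟩ := h i hx hxz
        refine (ih _ ?_ _ h1 rfl).trans h2.reachable
        rw [← hd, cometParent, Fin.val_succ]
        dsimp only
        omega

lemma comet_isTree {m r : ℕ} (hr : 1 ≤ r) : (comet (m + 1) r).IsTree := by
  rw [isTree_iff_connected_and_card]
  constructor
  · rw [connected_iff_exists_forall_reachable]
    exact ⟨0, fun x ↦ comet_reachable_zero (r := r) Set.univ 0
      (fun i _ _ ↦ ⟨trivial, comet_adj_cometParent hr i⟩) (fun _ ↦ rfl) x trivial⟩
  · rw [comet_edgeSet_eq hr, ← Nat.card_congr (Equiv.ofInjective _ (cometEdge_injective m r))]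
    simp

/-- The part of the comet beyond the edge that joins the vertex `i + 1` to its parent. -/
def cometBranch (m r : ℕ) (i : Fin m) : Set (Fin (m + 1)) :=
  {x | if i.val + 1 < r then i.val + 1 ≤ x.val else x.val = i.val + 1}

lemma ncard_cometBranch (m r : ℕ) (i : Fin m) :
    (cometBranch m r i).ncard = if i.val + 1 < r then m - i.val else 1 := by
  split_ifs with h
  · have : cometBranch m r i = Finset.Ici i.succ := by
      ext x
      simp [cometBranch, h, Fin.le_def]
    rw [this, Set.ncard_coe_finset, Fin.card_Ici, Fin.val_succ]
    omega
  · have : cometBranch m r i = {i.succ} := by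
      ext x
      simp [cometBranch, h, Fin.ext_iff]
    rw [this, Set.ncard_singleton]

/-- After the deletion the branch stays connected to `i.succ` and its complement to `0`; these two
are separated because the edge is a bridge. -/
lemma comet_farSide_zero {m r : ℕ} (hr : 1 ≤ r) (i : Fin m) :
    (comet (m + 1) r).farSide (cometEdge m r i) 0 = cometBranch m r i := by
  have hadj (j : Fin m) (hj : j ≠ i) :
      ((comet (m + 1) r).deleteEdges {cometEdge m r i}).Adj (cometParent m r j) j.succ := by
    rw [deleteEdges_adj]
    exact ⟨comet_adj_cometParent hr j, fun h ↦ hj (cometEdge_injective m r h)⟩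
  have h1 : ∀ x ∈ cometBranch m r i,
      ((comet (m + 1) r).deleteEdges {cometEdge m r i}).Reachable i.succ x := by
    refine comet_reachable_zero (r := r) _ _ (fun j hj hne ↦ ⟨?_, hadj j ?_⟩) ?_
    · simp only [cometBranch, Set.mem_ofPred_eq, Fin.val_succ, cometParent, Ne, Fin.ext_iff]
        at hj hne ⊢
      split_ifs at hj ⊢ <;> omega
    · rintro rfl
      exact hne rfl
    · intro h
      simp only [cometBranch, Set.mem_ofPred_eq, Fin.val_zero] at h
      split_ifs at h
      all_goals omega
  have h2 : ∀ x ∈ (cometBranch m r i)ᶜ,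
      ((comet (m + 1) r).deleteEdges {cometEdge m r i}).Reachable 0 x := by
    refine comet_reachable_zero (r := r) _ _ (fun j hj _ ↦ ⟨?_, hadj j ?_⟩) fun _ ↦ rfl
    · simp only [cometBranch, Set.mem_ofPred_eq, Set.mem_compl_iff, Fin.val_succ, cometParent]
        at hj ⊢
      split_ifs at hj ⊢ <;> omega
    · rintro rfl
      simp [cometBranch] at hj
  have h3 : ¬ ((comet (m + 1) r).deleteEdges {cometEdge m r i}).Reachable 0 i.succ := by
    intro h
    have hb : (comet (m + 1) r).IsBridge (cometEdge m r i) :=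
      isAcyclic_iff_forall_isBridge.1 (comet_isTree hr).isAcyclic (comet_adj_cometParent hr i)
    refine isBridge_iff.1 hb ((h2 _ ?_).symm.trans h)
    simp only [cometBranch, Set.mem_ofPred_eq, Set.mem_compl_iff, cometParent]
    split_ifs <;> omega
  ext x
  refine ⟨fun hx ↦ ?_, fun hx h ↦ h3 (h.trans (h1 x hx).symm)⟩
  by_contra h
  exact hx (h2 x h)

lemma comet_steinerKDist {m r : ℕ} (hr : 1 ≤ r) (k : ℕ) (v : Fin (m + 1)) :
    (comet (m + 1) r).steinerKDist k v = ∑ i : Fin m, Nat.chooseMeet (m + 1) k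
      ((comet (m + 1) r).farSide (cometEdge m r i) v).ncard := by
  classical
  have h : (comet (m + 1) r).edgeFinset = Finset.univ.image (cometEdge m r) := by
    rw [← Finset.coe_inj, coe_edgeFinset, comet_edgeSet_eq hr]
    simp
  rw [(comet_isTree hr).steinerKDist_eq_sum, h,
    Finset.sum_image (fun _ _ _ _ h ↦ cometEdge_injective m r h), Fintype.card_fin]

lemma comet_steinerKDist_zero {m r : ℕ} (hr : 1 ≤ r) (hrm : r ≤ m) (k : ℕ) :
    (comet (m + 1) r).steinerKDist k 0 = cometEndDist (m + 1) k r := by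
  obtain ⟨r, rfl⟩ : ∃ s, r = s + 1 := ⟨r - 1, by omega⟩
  obtain ⟨t, rfl⟩ : ∃ t, m = r + (t + 1) := ⟨m - r - 1, by omega⟩
  simp only [comet_steinerKDist hr, comet_farSide_zero hr, ncard_cometBranch]
  rw [Fin.sum_univ_eq_sum_range (fun i ↦ Nat.chooseMeet (r + (t + 1) + 1) k
    (if i + 1 < r + 1 then r + (t + 1) - i else 1)), Finset.sum_range_add, cometEndDist,
    add_assoc (Finset.sum _ _)]
  congr 1
  · refine Finset.sum_congr rfl fun i hi ↦ ?_
    rw [Finset.mem_range] at hi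
    rw [if_pos (by omega)]
    congr 1
    omega
  -- There are `t + 1` pendant edges; one supplies the separate middle term of `cometEndDist`.
  · simp only [show ∀ x, ¬ (r + x + 1 < r + 1) by omega, if_false, Finset.sum_const,
      Finset.card_range, smul_eq_mul]
    rw [show r + (t + 1) + 1 - 1 - (r + 1) = t by omega]
    ring

/-- The far side from `a` equals the one from `0`, or is its complement when `a` lies in the branch.
-/
lemma comet_ncard_farSide {m r : ℕ} (hr : 1 ≤ r) (i : Fin m) {a : Fin (m + 1)}
    (ha : r ≤ a.val) : ((comet (m + 1) r).farSide (cometEdge m r i) a).ncard =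
      if i.val + 1 < r then i.val + 1 else if i.val + 1 = a.val then m else 1 := by
  have h0 := comet_farSide_zero hr i
  have hc := ncard_cometBranch m r i
  by_cases hm : a ∈ cometBranch m r i
  · rw [← h0] at hm
    have := (comet_isTree hr).connected.ncard_farSide_add hm
    rw [h0, hc, Fintype.card_fin] at this
    rw [h0] at hm
    simp only [cometBranch, Set.mem_ofPred_eq] at hm
    split_ifs at hm this ⊢ <;> omega
  · rw [← h0] at hm
    rw [← farSide_eq_of_notMem hm, h0, hc]
    rw [h0] at hm
    simp only [cometBranch, Set.mem_ofPred_eq] at hm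
    split_ifs at hm ⊢ <;> omega

lemma comet_steinerKDist_pendant {m r : ℕ} (hr : 1 ≤ r) (k : ℕ) {a : Fin (m + 1)}
    (ha : r ≤ a.val) : (comet (m + 1) r).steinerKDist k a = cometPendantDist (m + 1) k r := by
  obtain ⟨r, rfl⟩ : ∃ s, r = s + 1 := ⟨r - 1, by omega⟩
  obtain ⟨t, rfl⟩ : ∃ t, m = r + (t + 1) := ⟨m - r - 1, by omega⟩
  simp only [comet_steinerKDist hr, comet_ncard_farSide hr _ ha]
  rw [Fin.sum_univ_eq_sum_range (fun i ↦ Nat.chooseMeet (r + (t + 1) + 1) k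
    (if i + 1 < r + 1 then i + 1 else if i + 1 = a.val then r + (t + 1) else 1)),
    Finset.sum_range_add, cometPendantDist, add_assoc (Finset.sum _ _)]
  congr 1
  · refine Finset.sum_congr rfl fun i hi ↦ ?_
    rw [Finset.mem_range] at hi
    rw [if_pos (by omega)]
  -- The index of the edge at `a`, the only pendant edge with `n - 1` vertices beyond it.
  · have hmem : a.val - (r + 1) ∈ Finset.range (t + 1) := by
      rw [Finset.mem_range]; omega
    rw [← Finset.add_sum_erase _ _ hmem]
    congr 1
    · rw [if_neg (by omega), if_pos (by omega)]
      congr 1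
    · rw [Finset.sum_congr rfl (g := fun _ ↦ Nat.chooseMeet (r + (t + 1) + 1) k 1)]
      · rw [Finset.sum_const, Finset.card_erase_of_mem hmem, Finset.card_range, smul_eq_mul]
        congr 1
        omega
      · intro x hx
        rw [Finset.mem_erase] at hx
        rw [if_neg (by omega), if_neg (by omega)]

lemma comet_isLeafVertex_pendant {m r : ℕ} (hr : 1 ≤ r) {a : Fin (m + 1)} (ha : r ≤ a.val) :
    (comet (m + 1) r).IsLeafVertex a := by
  refine ⟨⟨r - 1, by omega⟩, ?_, fun y hy ↦ ?_⟩
  · dsimp only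
    rw [comet_adj_iff]
    dsimp only
    omega
  · dsimp only at hy
    rw [comet_adj_iff] at hy
    rw [Fin.ext_iff]
    dsimp only
    omega

lemma comet_isLeafVertex_zero {m r : ℕ} (hr : 1 ≤ r) (hrm : r ≤ m) (h : 2 ≤ r ∨ m = 1) :
    (comet (m + 1) r).IsLeafVertex 0 := by
  refine ⟨⟨1, by omega⟩, ?_, fun y hy ↦ ?_⟩
  · dsimp only
    rw [comet_adj_iff, Fin.val_zero]
    dsimp only
    omega
  · dsimp only at hy
    rw [comet_adj_iff, Fin.val_zero] at hy
    rw [Fin.ext_iff]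
    dsimp only
    omega

lemma IsLeafVertex.map_iso {V W : Type*} {G : SimpleGraph V} {G' : SimpleGraph W} (φ : G ≃g G')
    {v : V} (h : G.IsLeafVertex v) : G'.IsLeafVertex (φ v) := by
  obtain ⟨u, hu, huniq⟩ := h
  refine ⟨φ u, φ.map_adj_iff.2 hu, fun y hy ↦ ?_⟩
  obtain ⟨x, rfl⟩ := φ.surjective y
  rw [huniq x (φ.map_adj_iff.1 hy)]

end SimpleGraph

/-! ### The theorem. -/

theorem mainTheorem2 (n k : ℕ) (hk : 2 ≤ k) (hkn : k ≤ n) :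
    -- a maximizing `r` exists, and it can be chosen so that the path end of the comet is a leaf
    (∃ r : ℕ, IsLeafRatioMaximizer n k r ∧ (2 ≤ r ∨ n = 2)) ∧
    ∀ r : ℕ, IsLeafRatioMaximizer n k r →
      -- the two bounds
      (∀ (V : Type*) [Fintype V] [DecidableEq V] (T : SimpleGraph V),
        T.IsTree → Fintype.card V = n →
        ∀ v w : V, T.IsLeafVertex v → T.IsLeafVertex w →
          1 / leafRatioBound n k r ≤ (T.steinerKDist k v : ℝ) / (T.steinerKDist k w : ℝ) ∧
          (T.steinerKDist k v : ℝ) / (T.steinerKDist k w : ℝ) ≤ leafRatioBound n k r) ∧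
      -- the extremal trees
      (∀ (V : Type*) [Fintype V] [DecidableEq V] (T : SimpleGraph V) (a b : V),
        T.IsComet n r a b →
          T.IsTree ∧ T.IsLeafVertex a ∧ ((2 ≤ r ∨ n = 2) → T.IsLeafVertex b) ∧
          (T.steinerKDist k b : ℝ) / (T.steinerKDist k a : ℝ) = leafRatioBound n k r ∧
          (T.steinerKDist k a : ℝ) / (T.steinerKDist k b : ℝ) = 1 / leafRatioBound n k r) := by
  refine ⟨exists_isLeafRatioMaximizer hk hkn, fun r hr ↦ ⟨?_, ?_⟩⟩
  · intro V _ _ T hT hcard v w hv hw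
    subst hcard
    refine ⟨?_, hT.steinerKDist_div_le hk hkn hr hw⟩
    have hv' : 0 < (T.steinerKDist k v : ℝ) := by exact_mod_cast hT.steinerKDist_pos hk hkn hv
    have hw' : 0 < (T.steinerKDist k w : ℝ) := by exact_mod_cast hT.steinerKDist_pos hk hkn hw
    -- The lower bound is the upper bound for `w` over `v`, inverted.
    rw [← one_div_div (T.steinerKDist k w : ℝ)]
    exact one_div_le_one_div_of_le (div_pos hw' hv') (hT.steinerKDist_div_le hk hkn hr hv)
  · rintro V _ _ T a b ⟨φ, i, j, hi, hj, rfl, rfl⟩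
    obtain ⟨m, rfl⟩ : ∃ m, n = m + 1 := ⟨n - 1, by omega⟩
    obtain ⟨h1, h2⟩ := hr.1
    obtain rfl : j = 0 := Fin.ext hj
    have hF := leafRatioBound_eq hk hkn h1 h2
    have h3 : r ≤ m := h2
    rw [SimpleGraph.steinerKDist_apply, SimpleGraph.steinerKDist_apply,
      SimpleGraph.comet_steinerKDist_zero h1 h3, SimpleGraph.comet_steinerKDist_pendant h1 k hi]
    refine ⟨φ.isTree_iff.1 (SimpleGraph.comet_isTree h1),
      (SimpleGraph.comet_isLeafVertex_pendant h1 hi).map_iso φ,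
      fun h ↦ (SimpleGraph.comet_isLeafVertex_zero h1 h3 (by omega)).map_iso φ, hF.symm, ?_⟩
    rw [hF, one_div_div]
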